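/- Let $K$ be a commutative ring and let $\mathcal{P}$ be the set of all integer partitions, identified with their Young diagrams. For $\mu\subset\lambda$ in $\mathcal{P}$, a reverse plane partition of shape $\lambda/\mu$ is a filling of the boxes of $\lambda/\mu$ with positive integers that increases weakly along every row and every column. The dual stable Grothendieck polynomial is $$g_{\lambda/\mu}=\sum_T\prod_{i\ge1}x_i^{T(i)}\in K[[x_1,x_2,\dots]],$$ the sum over all reverse plane partitions $T$ of shape $\lambda/\mu$, where $T(i)$ is the number of columns of $T$ that contain $i$. Put $g_\lambda=g_{\lambda/\emptyset}$. Let $c(\lambda/\mu)$ be the number of columns of $\lambda/\mu$ that contain at least one box, and $c(\lambda)=c(\lambda/\emptyset)$. (1) For all $\mu,\nu\in\mathcal{P}$ there is exactly one family $(d^{\lambda}_{\mu\nu})_{\lambda\in\mathcal{P}}$ in $K$ with finitely many nonzero members such that $g_\mu g_\nu=\sum_\lambda d^{\lambda}_{\mu\nu}g_\lambda$, and it satisfies $$\sum_\lambda d^{\lambda}_{\mu\nu}=1,\qquad \sum_\lambda d^{\lambda}_{\mu\nu}\,t^{c(\lambda)}=t^{c(\mu)+c(\nu)}\quad\text{for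 every }t\in K.$$ (2) For all $\lambda,\mu\in\mathcal{P}$ with $\mu\subset\lambda$ there is exactly one family $(c^{\lambda}_{\mu\nu})_{\nu\in\mathcal{P}}$ in $K$ with finitely many nonzero members such that $g_{\lambda/\mu}=\sum_\nu c^{\lambda}_{\mu\nu}g_\nu$, and it satisfies $$\sum_\nu c^{\lambda}_{\mu\nu}=1,\qquad \sum_\nu c^{\lambda}_{\mu\nu}\,t^{c(\nu)}=t^{c(\lambda/\mu)}\quad\text{for every }t\in K.$$ -/

import Mathlib

/-- The boxes of the skew shape `lam/mu` (used for `mu ≤ lam`, i.e. `mu ⊆ lam`).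
A box `(i, j)` lies in row `i` and column `j`. -/
def skewCells (lam mu : YoungDiagram) : Finset (ℕ × ℕ) := lam.cells \ mu.cells

/-- `c(lam/mu)`, the number of (nonempty) columns of the skew shape `lam/mu`. -/
def numColumns (lam mu : YoungDiagram) : ℕ := ((skewCells lam mu).image Prod.snd).card

/-- A filling of the boxes of `lam/mu` is a reverse plane partition if the entries increase weakly
along every row and along every column. The letters `1 < 2 < 3 < ⋯` are encoded as the natural
numbers `0 < 1 < 2 < ⋯`. -/
def IsReversePlanePartition {lam mu : YoungDiagram} (T : skewCells lam mu → ℕ) : Prop :=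
  (∀ a b : skewCells lam mu, a.1.1 = b.1.1 → a.1.2 ≤ b.1.2 → T a ≤ T b) ∧
  (∀ a b : skewCells lam mu, a.1.2 = b.1.2 → a.1.1 ≤ b.1.1 → T a ≤ T b)

/-- The exponent of the monomial `x^T`: the exponent of `x_k` is the number of columns of `T`
that contain the letter `k`. -/
noncomputable def rppWeight {lam mu : YoungDiagram} (T : skewCells lam mu → ℕ) : ℕ →₀ ℕ :=
  Finsupp.onFinset (Finset.univ.image T)
    (fun k => ((Finset.univ.filter (fun a => T a = k)).image (fun a => a.1.2)).card)
    (by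
      intro k hk
      rw [Finset.card_ne_zero] at hk
      obtain ⟨_, hj⟩ := hk
      obtain ⟨a, ha, _⟩ := Finset.mem_image.1 hj
      exact Finset.mem_image.2 ⟨a, Finset.mem_univ a, (Finset.mem_filter.1 ha).2⟩)

/-- Only finitely many fillings contribute to a given monomial. -/
theorem finite_rppWeight_eq (lam mu : YoungDiagram) (m : ℕ →₀ ℕ) :
    {T : skewCells lam mu → ℕ | IsReversePlanePartition T ∧ rppWeight T = m}.Finite := by
  refine (Set.Finite.pi' (fun _ : skewCells lam mu => m.support.finite_toSet)).subset ?_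
  rintro T ⟨_, rfl⟩ a
  rw [Finset.mem_coe, Finsupp.mem_support_iff]
  exact Finset.card_ne_zero.2
    ⟨a.1.2, Finset.mem_image.2 ⟨a, Finset.mem_filter.2 ⟨Finset.mem_univ a, rfl⟩, rfl⟩⟩

/-- The dual stable Grothendieck polynomial `g_{lam/mu} = ∑_T x^T`, the sum running over all
reverse plane partitions `T` of shape `lam/mu`, as a formal power series in the variables
`x_0, x_1, x_2, …` over `K`. -/
noncomputable def dualGrothendieck (K : Type*) [CommRing K] (lam mu : YoungDiagram) :
    MvPowerSeries ℕ K := fun m =>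
  (({T : skewCells lam mu → ℕ | IsReversePlanePartition T ∧ rppWeight T = m}.ncard : ℕ) : K)

/-- `a` is the (finite) family of coefficients of an expansion `f = ∑_lam a_lam g_lam`, where
`g_lam = g_{lam/∅}`. -/
def IsExpansion {K : Type*} [CommRing K] (f : MvPowerSeries ℕ K) (a : YoungDiagram →₀ K) : Prop :=
  f = a.sum (fun lam r => r • dualGrothendieck K lam ⊥)

/-!
The sublevel sets of a reverse plane partition of shape `λ/μ` form a chain of Young diagrams from
`μ` to `λ`, and the exponent of `x_k` in its monomial is the number of columns of the `k`-th step of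
the chain. Hence `g_{λ/μ}` is symmetric as soon as, for `α ≤ β`, the number of diagrams `ν` between
`α` and `β` such that `ν/α` has `s` columns and `β/ν` has `t` columns is symmetric in `s` and `t`.
Describing `ν` by its column lengths, one computes the generating function of these diagrams one
column at a time, the columns treated so far being bounded below by the next one. The resulting
polynomials are not symmetric in their two variables, but become so when the bound is relaxed, and
relaxing it changes nothing when it is void.

The lexicographically largest monomial of `g_λ` is `x ^ λ`, with coefficient `1`, and a symmetric
function is determined by the coefficients of such monomials. So the `g_λ` form a basis of the ring
of symmetric functions, to which both `g_μ g_ν` and `g_{λ/μ}` belong.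

Setting all variables except `x_0` to `0` leaves only the constant filling and is therefore a ring
homomorphism that sends `g_{λ/μ}` to `x_0 ^ c(λ/μ)`. Applied to an expansion, it gives the
identities in `t`; the sum of the coefficients is the case `t = 1`.
-/

section ColumnTransfer

section CommSemiring

variable {R : Type*} [CommSemiring R]

/-- The weight of a column of the middle diagram of `α ≤ ν ≤ β` whose lengths in `α`, `ν` and `β`
are `A`, `p` and `B`: a factor `x` if the column meets `ν/α`, a factor `y` if it meets `β/ν`. -/
def columnWeight (x y : R) (A B p : ℕ) : R :=
  (if A < p then x else 1) * (if p < B then y else 1)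

/-- The sum of the weights `w 0 p₀ * ⋯ * w (k - 1) pₖ₋₁` over all sequences
`p₀ ≥ ⋯ ≥ pₖ₋₁ ≥ q` with `a j ≤ pⱼ ≤ b j`. -/
def transferSum (w : ℕ → ℕ → R) (a b : ℕ → ℕ) : ℕ → ℕ → R
  | 0, _ => 1
  | k + 1, q => ∑ p ∈ Finset.Icc (max q (a k)) (b k), w k p * transferSum w a b k p

/-- The transfer sum for the weights `columnWeight`. -/
def columnSum (x y : R) (a b : ℕ → ℕ) : ℕ → ℕ → R :=
  transferSum (fun j => columnWeight x y (a j) (b j)) a b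

/-- The part of `relaxedSum` in which the last term sticks to its minimum below `q`, without the
factor `y` of that term. -/
def tailSum (x y : R) (a b : ℕ → ℕ) : ℕ → ℕ → R
  | 0, _ => 0
  | k + 1, q => if a k < q then columnSum x y a b k q + y * tailSum x y a b k q else 0

/-- The variant of `columnSum` in which every term `pⱼ` is allowed to violate the bound `q` by
taking its minimal value `a j`. In contrast to `columnSum` itself it is symmetric in `x` and `y`. -/
def relaxedSum (x y : R) (a b : ℕ → ℕ) (k q : ℕ) : R :=
  columnSum x y a b k q + y * tailSum x y a b k q

variable {x y : R} {a b : ℕ → ℕ} {k q : ℕ}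

theorem tailSum_succ :
    tailSum x y a b (k + 1) q = if a k < q then relaxedSum x y a b k q else 0 :=
  rfl

theorem tailSum_eq_zero (ha : Antitone a) (hq : q ≤ a k) : tailSum x y a b k q = 0 := by
  cases k with
  | zero => rfl
  | succ k => exact if_neg (hq.trans (ha k.le_succ)).not_gt

theorem columnSum_succ_of_lt (hq : q < a k) :
    columnSum x y a b (k + 1) q = columnSum x y a b (k + 1) (q + 1) := by
  simp only [columnSum, transferSum, max_eq_right hq.le, max_eq_right (Nat.succ_le_of_lt hq)]

theorem columnSum_succ_of_le (hq : a k ≤ q) (hqb : q ≤ b k) :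
    columnSum x y a b (k + 1) q = columnSum x y a b (k + 1) (q + 1) +
      columnWeight x y (a k) (b k) q * columnSum x y a b k q := by
  simp only [columnSum, transferSum, max_eq_left hq, max_eq_left (le_add_right hq)]
  rw [← Finset.insert_Icc_add_one_left_eq_Icc hqb, Finset.sum_insert (by simp), add_comm]

theorem columnSum_succ_top (hab : a k ≤ b k) :
    columnSum x y a b (k + 1) (b k) =
      (if a k < b k then x else 1) * columnSum x y a b k (b k) := by
  simp [columnSum, transferSum, columnWeight, max_eq_left hab]

theorem relaxedSum_succ_top_of_eq (ha : Antitone a) (hab : a k = b k) :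
    relaxedSum x y a b (k + 1) (b k) = relaxedSum x y a b k (b k) := by
  rw [relaxedSum, tailSum_succ, columnSum_succ_top hab.le, if_neg hab.not_lt, if_neg hab.not_lt,
    relaxedSum, tailSum_eq_zero ha hab.ge]
  ring

end CommSemiring

section CommRing

variable {R : Type*} [CommRing R] {x y : R} {a b : ℕ → ℕ} {k q : ℕ}

theorem relaxedSum_eq_add (ha : Antitone a) (hq : ∀ j < k, q < b j) :
    relaxedSum x y a b k q = relaxedSum x y a b k (q + 1) + x * y * tailSum x y a b k q := by
  induction k with
  | zero => simp [relaxedSum, columnSum, tailSum, transferSum]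
  | succ k ih =>
    specialize ih fun j hj => hq j (hj.trans k.lt_succ_self)
    have hqb : q < b k := hq k k.lt_succ_self
    rw [relaxedSum, relaxedSum, tailSum_succ, tailSum_succ]
    rcases lt_trichotomy q (a k) with h | h | h
    · rw [if_neg h.not_gt, if_neg (Nat.succ_le_of_lt h).not_gt, columnSum_succ_of_lt h]
      ring
    · have hE : tailSum x y a b k q = 0 := tailSum_eq_zero ha h.le
      rw [if_neg h.not_gt, if_pos (h ▸ q.lt_succ_self), columnSum_succ_of_le h.ge hqb.le,
        columnWeight, if_neg h.not_gt, if_pos hqb]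
      rw [relaxedSum, hE] at ih
      linear_combination y * ih
    · rw [if_pos h, if_pos (h.trans q.lt_succ_self), columnSum_succ_of_le h.le hqb.le,
        columnWeight, if_pos h, if_pos hqb]
      rw [relaxedSum] at ih ⊢
      linear_combination y * ih

theorem relaxedSum_succ_top (hab : a k < b k) :
    relaxedSum x y a b (k + 1) (b k) =
      (x + y) * relaxedSum x y a b k (b k) - x * y * tailSum x y a b k (b k) := by
  rw [relaxedSum, tailSum_succ, columnSum_succ_top hab.le, if_pos hab, if_pos hab, relaxedSum]
  ring

theorem relaxedSum_comm_and_tailSum_comm (ha : Antitone a) (hb : Antitone b) (hab : a ≤ b)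
    (x y : R) (hq : ∀ j < k, q ≤ b j) :
    relaxedSum x y a b k q = relaxedSum y x a b k q ∧
      tailSum x y a b k q = tailSum y x a b k q := by
  induction k generalizing q with
  | zero => simp [relaxedSum, columnSum, tailSum, transferSum]
  | succ k ih =>
    have hS : ∀ p ≤ b k, relaxedSum x y a b k p = relaxedSum y x a b k p := fun p hp =>
      (ih fun j hj => hp.trans (hb hj.le)).1
    have hE : ∀ p ≤ b k, tailSum x y a b (k + 1) p = tailSum y x a b (k + 1) p := fun p hp => by
      rw [tailSum_succ, tailSum_succ, hS p hp]
    have hqb : q ≤ b k := hq k k.lt_succ_self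
    refine ⟨?_, hE q hqb⟩
    induction hqb using Nat.decreasingInduction with
    | self =>
      rcases (hab k).lt_or_eq with h | h
      · rw [relaxedSum_succ_top h, relaxedSum_succ_top h, hS _ le_rfl,
          (ih fun j hj => hb hj.le).2]
        ring
      · rw [relaxedSum_succ_top_of_eq ha h, relaxedSum_succ_top_of_eq ha h, hS _ le_rfl]
    | of_succ p hp ihp =>
      have hpb : ∀ j < k + 1, p < b j := fun j hj =>
        lt_of_lt_of_le hp (hb (Nat.lt_succ_iff.1 hj))
      rw [relaxedSum_eq_add ha hpb, relaxedSum_eq_add ha hpb, hE p hp.le, ihp hpb, mul_comm x y]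

theorem columnSum_zero_comm (ha : Antitone a) (hb : Antitone b) (hab : a ≤ b) (x y : R) (k : ℕ) :
    columnSum x y a b k 0 = columnSum y x a b k 0 := by
  have h := (relaxedSum_comm_and_tailSum_comm (k := k) ha hb hab x y fun _ _ => zero_le).1
  simpa only [relaxedSum, tailSum_eq_zero ha (Nat.zero_le _), mul_zero, add_zero] using h

end CommRing

end ColumnTransfer

section AntitoneSums

open Classical in
/-- The finitely supported antitone sequences between `a` and `b`, i.e. the sequences of column
lengths of the Young diagrams between two given ones. -/
noncomputable def antitoneIcc (a b : ℕ →₀ ℕ) : Finset (ℕ →₀ ℕ) :=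
  {f ∈ Finset.Icc a b | Antitone f}

theorem mem_antitoneIcc {a b f : ℕ →₀ ℕ} : f ∈ antitoneIcc a b ↔ (a ≤ f ∧ f ≤ b) ∧ Antitone f := by
  simp only [antitoneIcc, Finset.mem_filter, Finset.mem_Icc]

theorem antitone_update {f : ℕ → ℕ} {k p : ℕ} (hf : Antitone f)
    (hlt : ∀ j < k, p ≤ f j) (hgt : ∀ j, k < j → f j ≤ p) : Antitone (Function.update f k p) := by
  intro j l hjl
  by_cases hj : j = k <;> by_cases hl : l = k <;>
    grind [Antitone, Function.update_apply]

variable {a b : ℕ →₀ ℕ}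

theorem update_mem_antitoneIcc {f : ℕ →₀ ℕ} {k p : ℕ} (hf : f ∈ antitoneIcc a b) (hap : a k ≤ p)
    (hpb : p ≤ b k) (hlt : ∀ j < k, p ≤ f j) (hgt : ∀ j, k < j → f j ≤ p) :
    f.update k p ∈ antitoneIcc a b := by
  obtain ⟨⟨haf, hfb⟩, hanti⟩ := mem_antitoneIcc.1 hf
  refine mem_antitoneIcc.2 ⟨⟨fun j => ?_, fun j => ?_⟩, ?_⟩
  · rw [Finsupp.update_apply]
    split_ifs with h
    exacts [h ▸ hap, haf j]
  · rw [Finsupp.update_apply]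
    split_ifs with h
    exacts [h ▸ hpb, hfb j]
  · rw [Finsupp.coe_update]
    exact antitone_update hanti hlt hgt

open Classical in
/-- The range of summation of `transferSum`: the sequences in `antitoneIcc a b` whose first `k`
terms are at least `q` and whose remaining terms are those of `a`. -/
noncomputable def transferRange (a b : ℕ →₀ ℕ) (k q : ℕ) : Finset (ℕ →₀ ℕ) :=
  {f ∈ antitoneIcc a b | (∀ j < k, q ≤ f j) ∧ ∀ j ≥ k, f j = a j}

theorem mem_transferRange {f : ℕ →₀ ℕ} {k q : ℕ} : f ∈ transferRange a b k q ↔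
    f ∈ antitoneIcc a b ∧ (∀ j < k, q ≤ f j) ∧ ∀ j ≥ k, f j = a j := by
  simp only [transferRange, Finset.mem_filter]

theorem transferRange_zero (ha : Antitone a) (hab : a ≤ b) (q : ℕ) :
    transferRange a b 0 q = {a} := by
  ext f
  simp only [mem_transferRange, mem_antitoneIcc, Finset.mem_singleton]
  exact ⟨fun h => DFunLike.ext _ _ fun j => h.2.2 j j.zero_le,
    by rintro rfl; simpa [hab] using ha⟩

theorem update_mem_transferRange_succ (ha : Antitone a) {g : ℕ →₀ ℕ} {k p q : ℕ}
    (hp : p ∈ Finset.Icc (max q (a k)) (b k)) (hg : g ∈ transferRange a b k p) :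
    g.update k p ∈ transferRange a b (k + 1) q := by
  simp only [Finset.mem_Icc, max_le_iff] at hp
  obtain ⟨⟨hq, hap⟩, hpb⟩ := hp
  obtain ⟨hg, hpg, hga⟩ := mem_transferRange.1 hg
  refine mem_transferRange.2 ⟨update_mem_antitoneIcc hg hap hpb hpg fun j hj => ?_, ?_, ?_⟩
  · exact hga j hj.le ▸ (ha hj.le).trans hap
  · grind
  · grind

theorem apply_mem_Icc_of_mem_transferRange_succ {f : ℕ →₀ ℕ} {k q : ℕ}
    (hf : f ∈ transferRange a b (k + 1) q) : f k ∈ Finset.Icc (max q (a k)) (b k) := by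
  obtain ⟨hf, hqf, -⟩ := mem_transferRange.1 hf
  obtain ⟨⟨haf, hfb⟩, -⟩ := mem_antitoneIcc.1 hf
  exact Finset.mem_Icc.2 ⟨max_le (hqf k k.lt_succ_self) (haf k), hfb k⟩

theorem update_mem_transferRange (ha : Antitone a) (hab : a ≤ b) {f : ℕ →₀ ℕ} {k q : ℕ}
    (hf : f ∈ transferRange a b (k + 1) q) : f.update k (a k) ∈ transferRange a b k (f k) := by
  obtain ⟨hf, -, hfa⟩ := mem_transferRange.1 hf
  obtain ⟨⟨haf, -⟩, hanti⟩ := mem_antitoneIcc.1 hf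
  refine mem_transferRange.2 ⟨?_, fun j hj => ?_, ?_⟩
  · exact update_mem_antitoneIcc hf le_rfl (hab k) (fun j hj => (haf k).trans (hanti hj.le))
      fun j hj => hfa j hj ▸ ha hj.le
  · simpa [Finsupp.update_apply, hj.ne] using hanti hj.le
  · grind

theorem transferSum_eq_sum {R : Type*} [CommSemiring R] (w : ℕ → ℕ → R) (ha : Antitone a)
    (hab : a ≤ b) (k q : ℕ) :
    transferSum w a b k q =
      ∑ f ∈ transferRange a b k q, ∏ j ∈ Finset.range k, w j (f j) := by
  induction k generalizing q with
  | zero => simp [transferSum, transferRange_zero ha hab]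
  | succ k ih =>
    simp only [transferSum, ih, Finset.mul_sum]
    rw [Finset.sum_sigma']
    refine Finset.sum_nbij' (fun g => g.2.update k g.1) (fun f => ⟨f k, f.update k (a k)⟩)
      (fun g hg => ?_) (fun f hf => ?_) ?_ ?_ ?_
    · rw [Finset.mem_sigma] at hg
      exact update_mem_transferRange_succ ha hg.1 hg.2
    · exact Finset.mem_sigma.2
        ⟨apply_mem_Icc_of_mem_transferRange_succ hf, update_mem_transferRange ha hab hf⟩
    · rintro ⟨p, g⟩ h
      rw [Finset.mem_sigma, mem_transferRange] at h
      have hg : g.update k (a k) = g := by rw [← h.2.2.2 k le_rfl, Finsupp.update_self]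
      simp [hg]
    · intro f _
      simp
    · rintro ⟨p, g⟩ -
      rw [Finset.prod_range_succ, mul_comm]
      congr 1
      · refine Finset.prod_congr rfl fun j hj => ?_
        simp [Finsupp.update_apply, (Finset.mem_range.1 hj).ne]
      · simp

theorem prod_columnWeight {R : Type*} [CommSemiring R] (x y : R) {f : ℕ →₀ ℕ} {n : ℕ}
    (hn : ∀ j ≥ n, b j = 0) (hfb : f ≤ b) :
    ∏ j ∈ Finset.range n, columnWeight x y (a j) (b j) (f j) =
      x ^ (f - a).support.card * y ^ (b - f).support.card := by
  have hfn : ∀ j ≥ n, f j = 0 := fun j hj => Nat.le_zero.1 ((hfb j).trans_eq (hn j hj))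
  have hx : (f - a).support = {j ∈ Finset.range n | a j < f j} := by
    ext j; simp [Nat.sub_eq_zero_iff_le]; grind
  have hy : (b - f).support = {j ∈ Finset.range n | f j < b j} := by
    ext j; simp [Nat.sub_eq_zero_iff_le]; grind
  simp only [columnWeight, Finset.prod_mul_distrib, Finset.prod_ite, Finset.prod_const, one_pow,
    mul_one, hx, hy]

theorem sum_antitoneIcc_comm {R : Type*} [CommRing R] (ha : Antitone a) (hb : Antitone b)
    (hab : a ≤ b) (x y : R) :
    ∑ f ∈ antitoneIcc a b, x ^ (f - a).support.card * y ^ (b - f).support.card =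
      ∑ f ∈ antitoneIcc a b, y ^ (f - a).support.card * x ^ (b - f).support.card := by
  obtain ⟨n, hn⟩ : ∃ n, ∀ j ≥ n, b j = 0 := by
    refine ⟨b.support.sup id + 1, fun j hj => Finsupp.notMem_support_iff.1 fun h => ?_⟩
    exact (Finset.le_sup (f := id) h).not_gt hj
  have hrange : transferRange a b n 0 = antitoneIcc a b := by
    ext f
    refine mem_transferRange.trans (and_iff_left_of_imp fun hf => ⟨fun _ _ => Nat.zero_le _, ?_⟩)
    intro j hj
    obtain ⟨⟨haf, hfb⟩, -⟩ := mem_antitoneIcc.1 hf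
    have hb0 : b j ≤ 0 := (hn j hj).le
    exact le_antisymm ((hfb j).trans (hb0.trans zero_le)) (haf j)
  have key (x y : R) : ∑ f ∈ antitoneIcc a b, x ^ (f - a).support.card * y ^ (b - f).support.card =
      columnSum x y a b n 0 := by
    rw [columnSum, transferSum_eq_sum _ ha hab, hrange]
    exact Finset.sum_congr rfl fun f hf =>
      (prod_columnWeight x y hn (mem_antitoneIcc.1 hf).1.2).symm
  rw [key, key, columnSum_zero_comm ha hb hab]

theorem card_filter_swap_of_sum_comm {ι : Type*} {S : Finset ι} {u v : ι → ℕ}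
    (h : ∀ x y : Polynomial (Polynomial ℤ),
      ∑ i ∈ S, x ^ u i * y ^ v i = ∑ i ∈ S, y ^ u i * x ^ v i) (s t : ℕ) :
    {i ∈ S | u i = s ∧ v i = t}.card = {i ∈ S | u i = t ∧ v i = s}.card := by
  have coeff_eq (u v : ι → ℕ) :
      ((∑ i ∈ S, (.C .X : Polynomial (Polynomial ℤ)) ^ u i * .X ^ v i).coeff t).coeff s =
        {i ∈ S | u i = s ∧ v i = t}.card := by
    rw [Finset.card_filter, Polynomial.finsetSum_coeff, Polynomial.finsetSum_coeff, Nat.cast_sum]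
    refine Finset.sum_congr rfl fun i _ => ?_
    rw [← Polynomial.C_pow, Polynomial.coeff_C_mul_X_pow]
    split_ifs <;> grind [Polynomial.coeff_zero]
  have key := congr(($(h (.C .X) .X)).coeff t |>.coeff s)
  simp only [mul_comm (Polynomial.X ^ u _)] at key
  rw [coeff_eq, coeff_eq, Nat.cast_inj] at key
  simpa only [and_comm] using key

end AntitoneSums

section Lengths

/-- The row lengths of a Young diagram as a finitely supported sequence; this is the partition that
the diagram encodes, and also the exponent of a monomial. -/
noncomputable def rowLengths (lam : YoungDiagram) : ℕ →₀ ℕ :=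
  Finsupp.onFinset (Finset.range (lam.colLen 0)) lam.rowLen fun _ hi =>
    Finset.mem_range.2 (YoungDiagram.mem_iff_lt_colLen.1
      (YoungDiagram.mem_iff_lt_rowLen.2 (Nat.pos_of_ne_zero hi)))

/-- The column lengths of a Young diagram as a finitely supported sequence. -/
noncomputable def columnLengths (lam : YoungDiagram) : ℕ →₀ ℕ :=
  rowLengths lam.transpose

variable {lam mu : YoungDiagram}

@[simp]
theorem rowLengths_apply (lam : YoungDiagram) (i : ℕ) : rowLengths lam i = lam.rowLen i :=
  rfl

@[simp]
theorem columnLengths_apply (lam : YoungDiagram) (j : ℕ) : columnLengths lam j = lam.colLen j :=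
  lam.rowLen_transpose j

theorem rowLengths_le_rowLengths : rowLengths mu ≤ rowLengths lam ↔ mu ≤ lam := by
  refine ⟨fun h ⟨i, j⟩ hc => ?_, fun h i => le_of_forall_lt fun j hj => ?_⟩
  · exact YoungDiagram.mem_iff_lt_rowLen.2 ((YoungDiagram.mem_iff_lt_rowLen.1 hc).trans_le (h i))
  · exact YoungDiagram.mem_iff_lt_rowLen.1 (h (YoungDiagram.mem_iff_lt_rowLen.2 hj))

theorem columnLengths_le_columnLengths : columnLengths mu ≤ columnLengths lam ↔ mu ≤ lam :=
  rowLengths_le_rowLengths.trans YoungDiagram.transpose_le_iff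

theorem rowLengths_injective : Function.Injective rowLengths := fun _ _ h =>
  le_antisymm (rowLengths_le_rowLengths.1 h.le) (rowLengths_le_rowLengths.1 h.ge)

theorem columnLengths_injective : Function.Injective columnLengths :=
  rowLengths_injective.comp fun _ _ => YoungDiagram.transpose_eq_iff.1

theorem antitone_rowLengths (lam : YoungDiagram) : Antitone (rowLengths lam) :=
  lam.rowLen_anti

theorem exists_rowLengths_eq {f : ℕ →₀ ℕ} (hf : Antitone f) : ∃ lam, rowLengths lam = f := by
  have hmem (c : ℕ × ℕ) : c ∈ (f.support ×ˢ Finset.range (f 0)).filter (fun c => c.2 < f c.1) ↔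
      c.2 < f c.1 := by
    simp only [Finset.mem_filter, Finset.mem_product, Finsupp.mem_support_iff, Finset.mem_range]
    have := hf (zero_le (a := c.1))
    omega
  let lam : YoungDiagram :=
    { cells := (f.support ×ˢ Finset.range (f 0)).filter fun c => c.2 < f c.1
      isLowerSet := fun c d hdc hc => (hmem d).2 <|
        hdc.2.trans_lt (((hmem c).1 hc).trans_le (hf hdc.1)) }
  refine ⟨lam, Finsupp.ext fun i => eq_of_forall_lt_iff fun j => ?_⟩
  exact YoungDiagram.mem_iff_lt_rowLen.symm.trans (hmem (i, j))

theorem exists_columnLengths_eq {f : ℕ →₀ ℕ} (hf : Antitone f) :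
    ∃ lam, columnLengths lam = f := by
  obtain ⟨lam, rfl⟩ := exists_rowLengths_eq hf
  exact ⟨lam.transpose, congrArg rowLengths lam.transpose_transpose⟩

theorem mem_skewCells {c : ℕ × ℕ} : c ∈ skewCells lam mu ↔ c ∈ lam ∧ c ∉ mu :=
  Finset.mem_sdiff

theorem image_snd_skewCells (lam mu : YoungDiagram) :
    (skewCells lam mu).image Prod.snd = (columnLengths lam - columnLengths mu).support := by
  ext j
  simp only [Finset.mem_image, mem_skewCells, Prod.exists, exists_eq_right,
    YoungDiagram.mem_iff_lt_colLen, Finsupp.mem_support_iff, Finsupp.tsub_apply,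
    columnLengths_apply, ne_eq, Nat.sub_eq_zero_iff_le, not_le, not_lt]
  exact ⟨fun ⟨_, h⟩ => h.2.trans_lt h.1, fun h => ⟨_, h, le_rfl⟩⟩

theorem numColumns_eq_card_support (lam mu : YoungDiagram) :
    numColumns lam mu = (columnLengths lam - columnLengths mu).support.card := by
  rw [numColumns, image_snd_skewCells]

/-- The Young diagrams `ν` with `α ≤ ν ≤ β` such that `ν/α` has `s` columns and `β/ν` has `t`
columns. -/
def intermediateDiagrams (α β : YoungDiagram) (s t : ℕ) : Set YoungDiagram :=
  {ν | α ≤ ν ∧ ν ≤ β ∧ numColumns ν α = s ∧ numColumns β ν = t}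

theorem image_columnLengths_intermediateDiagrams (α β : YoungDiagram) (s t : ℕ) :
    columnLengths '' intermediateDiagrams α β s t =
      {f ∈ antitoneIcc (columnLengths α) (columnLengths β) |
        (f - columnLengths α).support.card = s ∧ (columnLengths β - f).support.card = t} := by
  ext f
  simp only [Set.mem_image, Finset.coe_filter, mem_antitoneIcc, intermediateDiagrams]
  constructor
  · rintro ⟨ν, ⟨hαν, hνβ, rfl, rfl⟩, rfl⟩
    exact ⟨⟨⟨columnLengths_le_columnLengths.2 hαν, columnLengths_le_columnLengths.2 hνβ⟩,
      antitone_rowLengths _⟩, (numColumns_eq_card_support _ _).symm,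
      (numColumns_eq_card_support _ _).symm⟩
  · rintro ⟨⟨⟨hαf, hfβ⟩, hf⟩, rfl, rfl⟩
    obtain ⟨ν, rfl⟩ := exists_columnLengths_eq hf
    exact ⟨ν, ⟨columnLengths_le_columnLengths.1 hαf, columnLengths_le_columnLengths.1 hfβ,
      numColumns_eq_card_support _ _, numColumns_eq_card_support _ _⟩, rfl⟩

theorem exists_bijOn_intermediateDiagrams {α β : YoungDiagram} (hαβ : α ≤ β) (s t : ℕ) :
    ∃ φ, Set.BijOn φ (intermediateDiagrams α β s t) (intermediateDiagrams α β t s) := by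
  refine Set.Finite.exists_bijOn_of_encard_eq ?_ ?_
  · refine Set.Finite.of_finite_image ?_ columnLengths_injective.injOn
    rw [image_columnLengths_intermediateDiagrams]
    exact Finset.finite_toSet _
  · rw [← columnLengths_injective.encard_image, ← columnLengths_injective.encard_image,
      image_columnLengths_intermediateDiagrams, image_columnLengths_intermediateDiagrams,
      Set.encard_coe_eq_coe_finsetCard, Set.encard_coe_eq_coe_finsetCard, Nat.cast_inj]
    exact card_filter_swap_of_sum_comm (fun x y => sum_antitoneIcc_comm (antitone_rowLengths _)
      (antitone_rowLengths _) (columnLengths_le_columnLengths.2 hαβ) x y) s t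

end Lengths

section SublevelChains

variable {lam mu : YoungDiagram} {T : skewCells lam mu → ℕ} {ν : ℕ → YoungDiagram}

/-- The diagrams `ν k`, lying between `mu` and `lam`, are the sublevel sets of the filling `T`: they
consist of `mu` and of the boxes with an entry less than `k`. In this way a reverse plane partition
is encoded by a chain of Young diagrams from `mu` to `lam`. -/
structure IsSublevelChain (T : skewCells lam mu → ℕ) (ν : ℕ → YoungDiagram) : Prop where
  le_left : ∀ k, mu ≤ ν k
  le_right : ∀ k, ν k ≤ lam
  lt_iff_mem : ∀ a k, T a < k ↔ a.1 ∈ ν k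

theorem IsReversePlanePartition.mono (hT : IsReversePlanePartition T) {a b : skewCells lam mu}
    (hab : a.1 ≤ b.1) : T a ≤ T b := by
  obtain ⟨⟨i, j⟩, ha⟩ := a
  obtain ⟨⟨i', j'⟩, hb⟩ := b
  obtain ⟨hi, hj⟩ : i ≤ i' ∧ j ≤ j' := hab
  have hc : (i, j') ∈ skewCells lam mu :=
    mem_skewCells.2 ⟨lam.up_left_mem hi le_rfl (mem_skewCells.1 hb).1,
      fun hc => (mem_skewCells.1 ha).2 (mu.up_left_mem le_rfl hj hc)⟩
  calc T ⟨(i, j), ha⟩ ≤ T ⟨(i, j'), hc⟩ := hT.1 _ _ rfl hj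
    _ ≤ T ⟨(i', j'), hb⟩ := hT.2 _ _ rfl hi

theorem IsReversePlanePartition.exists_isSublevelChain (hle : mu ≤ lam)
    (hT : IsReversePlanePartition T) : ∃ ν, IsSublevelChain T ν := by
  classical
  let ν (k : ℕ) : YoungDiagram :=
    { cells := {c ∈ lam.cells | ∀ hc : c ∈ skewCells lam mu, T ⟨c, hc⟩ < k}
      isLowerSet := by
        intro c d hdc hc
        simp only [Finset.coe_filter, Set.mem_ofPred_eq] at hc ⊢
        refine ⟨lam.isLowerSet hdc hc.1, fun hd => ?_⟩
        have hc' : c ∈ skewCells lam mu :=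
          mem_skewCells.2 ⟨hc.1, fun h => (mem_skewCells.1 hd).2 (mu.isLowerSet hdc h)⟩
        exact (hT.mono hdc).trans_lt (hc.2 hc') }
  have hν (c : ℕ × ℕ) (k : ℕ) :
      c ∈ ν k ↔ c ∈ lam ∧ ∀ hc : c ∈ skewCells lam mu, T ⟨c, hc⟩ < k :=
    Finset.mem_filter
  refine ⟨ν, fun k c hc => (hν c k).2 ⟨hle hc, fun h => absurd hc (mem_skewCells.1 h).2⟩,
    fun k c hc => ((hν c k).1 hc).1, fun a k => ?_⟩
  exact ⟨fun h => (hν _ k).2 ⟨(mem_skewCells.1 a.2).1, fun _ => h⟩, fun h => ((hν _ k).1 h).2 a.2⟩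

namespace IsSublevelChain

theorem mem_iff (h : IsSublevelChain T ν) {c : ℕ × ℕ} {k : ℕ} :
    c ∈ ν k ↔ c ∈ lam ∧ ∀ hc : c ∈ skewCells lam mu, T ⟨c, hc⟩ < k := by
  refine ⟨fun hc => ⟨h.le_right k hc, fun hc' => (h.lt_iff_mem ⟨c, hc'⟩ k).2 hc⟩, fun hc => ?_⟩
  by_cases hmu : c ∈ mu
  · exact h.le_left k hmu
  · have hc' := mem_skewCells.2 ⟨hc.1, hmu⟩
    exact (h.lt_iff_mem ⟨c, hc'⟩ k).1 (hc.2 hc')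

theorem monotone (h : IsSublevelChain T ν) : Monotone ν := fun _ _ hkl _ hc =>
  h.mem_iff.2 ⟨(h.mem_iff.1 hc).1, fun hc' => ((h.mem_iff.1 hc).2 hc').trans_le hkl⟩

theorem chain_unique {ν' : ℕ → YoungDiagram} (h : IsSublevelChain T ν)
    (h' : IsSublevelChain T ν') : ν = ν' :=
  funext fun _ => SetLike.ext fun _ => h.mem_iff.trans h'.mem_iff.symm

theorem filling_unique {T' : skewCells lam mu → ℕ} (h : IsSublevelChain T ν)
    (h' : IsSublevelChain T' ν) : T = T' :=
  funext fun a => eq_of_forall_gt_iff fun k => (h.lt_iff_mem a k).trans (h'.lt_iff_mem a k).symm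

theorem isReversePlanePartition (h : IsSublevelChain T ν) : IsReversePlanePartition T := by
  have mono (a b : skewCells lam mu) (hab : a.1 ≤ b.1) : T a ≤ T b := by
    refine Nat.lt_succ_iff.1 ((h.lt_iff_mem a _).2 ?_)
    exact (ν _).isLowerSet hab ((h.lt_iff_mem b _).1 (T b).lt_succ_self)
  exact ⟨fun a b hi hj => mono a b ⟨hi.le, hj⟩, fun a b hj hi => mono a b ⟨hi, hj.le⟩⟩

theorem rppWeight_apply (h : IsSublevelChain T ν) (k : ℕ) :
    rppWeight T k = numColumns (ν (k + 1)) (ν k) := by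
  rw [rppWeight, Finsupp.onFinset_apply, numColumns]
  congr 1
  ext j
  simp only [Finset.mem_image, Finset.mem_filter, Finset.mem_univ, true_and, mem_skewCells]
  constructor
  · rintro ⟨a, rfl, rfl⟩
    exact ⟨a.1, ⟨(h.lt_iff_mem a _).1 (T a).lt_succ_self,
      fun hc => lt_irrefl _ ((h.lt_iff_mem a _).2 hc)⟩, rfl⟩
  · rintro ⟨c, ⟨hc_succ, hc⟩, rfl⟩
    have hc' : c ∈ skewCells lam mu :=
      mem_skewCells.2 ⟨h.le_right _ hc_succ, fun hmu => hc (h.le_left k hmu)⟩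
    have hlt := (h.lt_iff_mem ⟨c, hc'⟩ (k + 1)).2 hc_succ
    have hge := mt (h.lt_iff_mem ⟨c, hc'⟩ k).1 hc
    exact ⟨⟨c, hc'⟩, by omega, rfl⟩

end IsSublevelChain

/-- The filling obtained from `T` by redistributing the letters `i` and `i + 1`: among the boxes
containing one of them, those in `ρ` receive `i` and the others `i + 1`. -/
def redistribute (T : skewCells lam mu → ℕ) (i : ℕ) (ρ : YoungDiagram) (a : skewCells lam mu) : ℕ :=
  if T a = i ∨ T a = i + 1 then if a.1 ∈ ρ then i else i + 1 else T a

theorem IsSublevelChain.update (h : IsSublevelChain T ν) {i : ℕ} {ρ : YoungDiagram}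
    (hρ : ν i ≤ ρ) (hρ' : ρ ≤ ν (i + 2)) :
    IsSublevelChain (redistribute T i ρ) (Function.update ν (i + 1) ρ) := by
  refine ⟨fun k => ?_, fun k => ?_, fun a k => ?_⟩
  · rw [Function.update_apply]
    split_ifs
    exacts [(h.le_left i).trans hρ, h.le_left k]
  · rw [Function.update_apply]
    split_ifs
    exacts [hρ'.trans (h.le_right _), h.le_right k]
  · have h_low : T a < i → a.1 ∈ ρ := fun ha => hρ ((h.lt_iff_mem a i).1 ha)
    have h_high : a.1 ∈ ρ → T a < i + 2 := fun ha => (h.lt_iff_mem a (i + 2)).2 (hρ' ha)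
    have h_k := h.lt_iff_mem a k
    rw [Function.update_apply, redistribute]
    split_ifs <;> grind

theorem IsSublevelChain.eq_of_redistribute_eq {T' : skewCells lam mu → ℕ}
    {ν' : ℕ → YoungDiagram} (h : IsSublevelChain T ν) (h' : IsSublevelChain T' ν') {i : ℕ}
    {ρ ρ' : YoungDiagram} (hρ : ν i ≤ ρ) (hρ₂ : ρ ≤ ν (i + 2)) (hρ' : ν' i ≤ ρ')
    (hρ₂' : ρ' ≤ ν' (i + 2)) (heq : redistribute T i ρ = redistribute T' i ρ') :
    ρ = ρ' ∧ ∀ k ≠ i + 1, ν k = ν' k := by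
  have hupdate := (h.update hρ hρ₂).chain_unique (heq ▸ h'.update hρ' hρ₂')
  exact ⟨by simpa using congr($hupdate (i + 1)),
    fun k hk => by simpa [hk] using congr($hupdate k)⟩

/-- The reverse plane partitions of shape `lam/mu` that contribute to the monomial `x ^ m`. -/
def rppsOfWeight (lam mu : YoungDiagram) (m : ℕ →₀ ℕ) : Set (skewCells lam mu → ℕ) :=
  {T | IsReversePlanePartition T ∧ rppWeight T = m}

theorem finite_rppsOfWeight (lam mu : YoungDiagram) (m : ℕ →₀ ℕ) : (rppsOfWeight lam mu m).Finite :=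
  finite_rppWeight_eq lam mu m

theorem IsSublevelChain.redistribute_mem_rppsOfWeight (h : IsSublevelChain T ν) {i : ℕ}
    {ρ : YoungDiagram} (hρ : ρ ∈ intermediateDiagrams (ν i) (ν (i + 2)) (rppWeight T (i + 1))
      (rppWeight T i)) :
    redistribute T i ρ ∈
      rppsOfWeight lam mu ((rppWeight T).equivMapDomain (Equiv.swap i (i + 1))) := by
  have hU := h.update hρ.1 hρ.2.1
  refine ⟨hU.isReversePlanePartition, Finsupp.ext fun k => ?_⟩
  rw [hU.rppWeight_apply, Finsupp.equivMapDomain_apply, Equiv.symm_swap]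
  rcases eq_or_ne k i with rfl | hki
  · simpa using hρ.2.2.1
  rcases eq_or_ne k (i + 1) with rfl | hki'
  · simpa using hρ.2.2.2
  rw [Equiv.swap_apply_of_ne_of_ne hki hki', h.rppWeight_apply, Function.update_of_ne (by omega),
    Function.update_of_ne hki']

theorem ncard_rppsOfWeight_le (hle : mu ≤ lam) (m : ℕ →₀ ℕ) (i : ℕ) :
    (rppsOfWeight lam mu m).ncard ≤
      (rppsOfWeight lam mu (m.equivMapDomain (Equiv.swap i (i + 1)))).ncard := by
  have hchain (T : rppsOfWeight lam mu m) : ∃ ν, IsSublevelChain T.1 ν :=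
    T.2.1.exists_isSublevelChain hle
  choose ν hν using hchain
  have hbij (α β : YoungDiagram) (hαβ : α ≤ β) :=
    exists_bijOn_intermediateDiagrams hαβ (m i) (m (i + 1))
  choose! φ hφ using hbij
  let ρ (T : rppsOfWeight lam mu m) : YoungDiagram := φ (ν T i) (ν T (i + 2)) (ν T (i + 1))
  have hφν (T : rppsOfWeight lam mu m) := hφ _ _ ((hν T).monotone (Nat.le_add_right i 2))
  have hmem (T : rppsOfWeight lam mu m) :
      ν T (i + 1) ∈ intermediateDiagrams (ν T i) (ν T (i + 2)) (m i) (m (i + 1)) := by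
    obtain ⟨T, -, rfl⟩ := T
    exact ⟨(hν _).monotone i.le_succ, (hν _).monotone (i + 1).le_succ,
      ((hν _).rppWeight_apply i).symm, ((hν _).rppWeight_apply (i + 1)).symm⟩
  have hρ (T : rppsOfWeight lam mu m) : ρ T ∈ intermediateDiagrams (ν T i) (ν T (i + 2))
      (rppWeight T.1 (i + 1)) (rppWeight T.1 i) := T.2.2.symm ▸ (hφν T).mapsTo (hmem T)
  have := (finite_rppsOfWeight lam mu (m.equivMapDomain (Equiv.swap i (i + 1)))).to_subtype
  refine Nat.card_le_card_of_injective (fun T => ⟨redistribute T.1 i (ρ T), ?_⟩) fun T T' hTT' => ?_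
  · have h := (hν T).redistribute_mem_rppsOfWeight (hρ T)
    rwa [T.2.2] at h
  · obtain ⟨hρρ, h_ne⟩ := (hν T).eq_of_redistribute_eq (hν T') (hρ T).1 (hρ T).2.1 (hρ T').1
      (hρ T').2.1 (Subtype.ext_iff.1 hTT')
    have h_eq : ν T (i + 1) = ν T' (i + 1) := by
      refine (hφν T).injOn (hmem T) (h_ne i (by omega) ▸ h_ne (i + 2) (by omega) ▸ hmem T') ?_
      simpa only [ρ, h_ne i (by omega), h_ne (i + 2) (by omega)] using hρρ
    have hνν : ν T = ν T' := funext fun k => by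
      rcases eq_or_ne k (i + 1) with rfl | hk
      exacts [h_eq, h_ne k hk]
    exact Subtype.ext ((hν T).filling_unique (hνν ▸ hν T'))

theorem ncard_rppsOfWeight_swap (hle : mu ≤ lam) (m : ℕ →₀ ℕ) (i : ℕ) :
    (rppsOfWeight lam mu (m.equivMapDomain (Equiv.swap i (i + 1)))).ncard =
      (rppsOfWeight lam mu m).ncard := by
  refine le_antisymm ?_ (ncard_rppsOfWeight_le hle m i)
  have h := ncard_rppsOfWeight_le hle (m.equivMapDomain (Equiv.swap i (i + 1))) i
  rwa [← Finsupp.equivMapDomain_trans, Equiv.swap_swap, Finsupp.equivMapDomain_refl] at h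

end SublevelChains

section SymmetricFunctions

/-- The power series in the variables `x_s`, `s : σ`, whose monomials have degree at most `D`. -/
def degreeLE (σ R : Type*) [CommSemiring R] (D : ℕ) : Submodule R (MvPowerSeries σ R) where
  carrier := {f | ∀ m : σ →₀ ℕ, D < m.degree → MvPowerSeries.coeff m f = 0}
  add_mem' hf hg m hm := by rw [map_add, hf m hm, hg m hm, add_zero]
  zero_mem' _ _ := map_zero _
  smul_mem' r f hf m hm := by rw [map_smul, hf m hm, smul_zero]

theorem degreeLE_mono {σ R : Type*} [CommSemiring R] : Monotone (degreeLE σ R) :=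
  fun _ _ hDE _ hf m hm => hf m (hDE.trans_lt hm)

theorem mul_mem_degreeLE {σ R : Type*} [CommSemiring R] {D E : ℕ} {f g : MvPowerSeries σ R}
    (hf : f ∈ degreeLE σ R D) (hg : g ∈ degreeLE σ R E) : f * g ∈ degreeLE σ R (D + E) := by
  classical
  intro m hm
  rw [MvPowerSeries.coeff_mul]
  refine Finset.sum_eq_zero fun p hp => ?_
  rw [← Finset.HasAntidiagonal.mem_antidiagonal.1 hp, map_add] at hm
  rcases le_or_gt p.1.degree D with h | h
  · rw [hg p.2 (by omega), mul_zero]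
  · rw [hf p.1 h, zero_mul]

theorem algebraMap_mem_degreeLE {σ R : Type*} [CommSemiring R] (r : R) :
    algebraMap R (MvPowerSeries σ R) r ∈ degreeLE σ R 0 := by
  classical
  intro m hm
  rw [MvPowerSeries.algebraMap_apply, Algebra.algebraMap_self_apply, MvPowerSeries.coeff_C,
    if_neg (by rintro rfl; simp at hm)]

variable (K : Type*) [CommSemiring K]

/-- The ring of symmetric functions over `K` in the variables `x_0, x_1, …`: the power series of
bounded degree that are invariant under permutations of the variables. It suffices to require
invariance under the adjacent transpositions. -/
noncomputable def symmetricFunctions : Subalgebra K (MvPowerSeries ℕ K) where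
  carrier := {f | (∀ i, MvPowerSeries.renameEquiv K (Equiv.swap i (i + 1)) f = f) ∧
    ∃ D, f ∈ degreeLE ℕ K D}
  mul_mem' := fun ⟨hf, _, hD⟩ ⟨hg, _, hE⟩ =>
    ⟨fun i => by rw [map_mul, hf, hg], _, mul_mem_degreeLE hD hE⟩
  add_mem' := fun ⟨hf, _, hD⟩ ⟨hg, _, hE⟩ => ⟨fun i => by rw [map_add, hf, hg], _,
    add_mem (degreeLE_mono (le_max_left _ _) hD) (degreeLE_mono (le_max_right _ _) hE)⟩
  algebraMap_mem' r := ⟨fun _ => AlgEquiv.commutes _ r, 0, algebraMap_mem_degreeLE r⟩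

variable {K}

theorem renameEquiv_eq_self_iff {σ : Type*} {e : Equiv.Perm σ} {f : MvPowerSeries σ K} :
    MvPowerSeries.renameEquiv K e f = f ↔
      ∀ m, MvPowerSeries.coeff (m.equivMapDomain e) f = MvPowerSeries.coeff m f := by
  have coeff_renameEquiv (m : σ →₀ ℕ) :
      MvPowerSeries.coeff (m.equivMapDomain e) (MvPowerSeries.renameEquiv K e f) =
        MvPowerSeries.coeff m f := by
    rw [← MvPowerSeries.coeff_embDomain_rename e.toEmbedding f m, Finsupp.embDomain_eq_mapDomain,
      Finsupp.equivMapDomain_eq_mapDomain]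
    rfl
  refine ⟨fun h m => h ▸ (coeff_renameEquiv m).trans (by rw [h]), fun h => ?_⟩
  ext m
  obtain ⟨m, rfl⟩ := (Finsupp.equivCongrLeft e).surjective m
  exact (coeff_renameEquiv m).trans (h m).symm

theorem coeff_swap_of_mem_symmetricFunctions {f : MvPowerSeries ℕ K}
    (hf : f ∈ symmetricFunctions K) (m : ℕ →₀ ℕ) (i : ℕ) :
    MvPowerSeries.coeff (m.equivMapDomain (Equiv.swap i (i + 1))) f = MvPowerSeries.coeff m f :=
  renameEquiv_eq_self_iff.1 (hf.1 i) m

theorem card_eq_degree_rowLengths (lam : YoungDiagram) : lam.card = (rowLengths lam).degree := by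
  rw [Finsupp.degree_apply, YoungDiagram.card, Finset.card_eq_sum_card_fiberwise (f := Prod.fst)
    (t := (rowLengths lam).support)]
  · exact Finset.sum_congr rfl fun i _ => (YoungDiagram.rowLen_eq_card lam).symm
  · rintro ⟨i, j⟩ hc
    exact Finsupp.mem_support_iff.2 (YoungDiagram.mem_iff_lt_rowLen.1 hc).ne_bot

theorem finite_setOf_card_le (D : ℕ) : {lam : YoungDiagram | lam.card ≤ D}.Finite := by
  refine Set.Finite.of_finite_image (f := YoungDiagram.cells) ?_ fun _ _ _ _ => YoungDiagram.ext
  refine (Finset.finite_toSet (Finset.range D ×ˢ Finset.range D).powerset).subset ?_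
  rintro _ ⟨lam, hlam, rfl⟩
  refine Finset.mem_powerset.2 fun ⟨i, j⟩ hc => ?_
  have hi : i < lam.colLen j := YoungDiagram.mem_iff_lt_colLen.1 hc
  have hj : j < lam.rowLen i := YoungDiagram.mem_iff_lt_rowLen.1 hc
  rw [YoungDiagram.colLen_eq_card] at hi
  rw [YoungDiagram.rowLen_eq_card] at hj
  exact Finset.mem_product.2
    ⟨Finset.mem_range.2 ((hi.trans_le (Finset.card_filter_le _ _)).trans_le hlam),
      Finset.mem_range.2 ((hj.trans_le (Finset.card_filter_le _ _)).trans_le hlam)⟩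

theorem equivMapDomain_swap_add_single {σ M : Type*} [DecidableEq σ] [AddCommMonoid M]
    (m : σ →₀ M) (i j : σ) :
    m.equivMapDomain (Equiv.swap i j) + (Finsupp.single i (m i) + Finsupp.single j (m j)) =
      m + (Finsupp.single i (m j) + Finsupp.single j (m i)) := by
  ext k
  simp only [Finsupp.add_apply, Finsupp.equivMapDomain_apply, Equiv.symm_swap, Equiv.swap_apply_def,
    Finsupp.single_apply]
  grind [add_comm, add_left_comm, zero_add, add_zero]

theorem exists_coeff_eq_coeff_rowLengths {f : MvPowerSeries ℕ K} (hf : f ∈ symmetricFunctions K)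
    (m : ℕ →₀ ℕ) : ∃ lam : YoungDiagram, lam.card = m.degree ∧
      MvPowerSeries.coeff m f = MvPowerSeries.coeff (rowLengths lam) f := by
  -- Exchanging two adjacent exponents that are out of order decreases `∑ j, j * m j`.
  let W : (ℕ →₀ ℕ) →+ ℕ := Finsupp.liftAddHom fun j => AddMonoidHom.mulLeft j
  have W_single (j n : ℕ) : W (Finsupp.single j n) = j * n := by simp [W]
  induction hn : W m using Nat.strong_induction_on generalizing m with
  | _ n ih =>
    by_cases hm : Antitone m
    · obtain ⟨lam, rfl⟩ := exists_rowLengths_eq hm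
      exact ⟨lam, card_eq_degree_rowLengths lam, rfl⟩
    · obtain ⟨i, hi⟩ : ∃ i, m i < m (i + 1) := by
        contrapose! hm
        exact antitone_nat_of_succ_le hm
      have hswap := equivMapDomain_swap_add_single m i (i + 1)
      have hW := congrArg W hswap
      simp only [map_add, W_single, add_mul] at hW
      have hdeg := congrArg Finsupp.degree hswap
      simp only [map_add, Finsupp.degree_single] at hdeg
      obtain ⟨lam, hcard, hcoeff⟩ := ih _ (by omega) (m.equivMapDomain (Equiv.swap i (i + 1))) rfl
      refine ⟨lam, by omega, ?_⟩
      rw [← hcoeff, coeff_swap_of_mem_symmetricFunctions hf]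

theorem eq_zero_of_coeff_rowLengths_eq_zero {f : MvPowerSeries ℕ K} (hf : f ∈ symmetricFunctions K)
    {D : ℕ} (hD : f ∈ degreeLE ℕ K D)
    (h : ∀ lam : YoungDiagram, lam.card ≤ D → MvPowerSeries.coeff (rowLengths lam) f = 0) :
    f = 0 := by
  ext m
  obtain ⟨lam, hcard, hcoeff⟩ := exists_coeff_eq_coeff_rowLengths hf m
  rw [map_zero, hcoeff]
  by_cases hlam : lam.card ≤ D
  · exact h lam hlam
  · exact hcoeff ▸ hD m (hcard ▸ not_le.1 hlam)

end SymmetricFunctions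

section Unitriangular

variable {ι α R M : Type*} [CommRing R] [AddCommGroup M] [Module R M] [LinearOrder α]

/-- The functionals `φ` are dual to the family `v` up to a unitriangular matrix, the indices being
ordered by the key `b`. -/
structure IsUnitriangular (b : ι → α) (φ : ι → M →ₗ[R] R) (v : ι → M) : Prop where
  injective : Function.Injective b
  apply_self : ∀ i, φ i (v i) = 1
  apply_of_lt : ∀ i j, b j < b i → φ i (v j) = 0

namespace IsUnitriangular

variable {b : ι → α} {φ : ι → M →ₗ[R] R} {v : ι → M}

theorem isUnit_matrix [DecidableEq ι] (h : IsUnitriangular b φ v) (S : Finset ι) :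
    IsUnit (Matrix.of fun i j : S => φ i (v j)) := by
  let : LinearOrder S := LinearOrder.lift' (fun i : S => b i) fun i j hij =>
    Subtype.ext (h.injective hij)
  rw [Matrix.isUnit_iff_isUnit_det, Matrix.det_of_isUpperTriangular fun i j hij => ?_]
  · simp [h.apply_self]
  · exact h.apply_of_lt i j hij

theorem linearIndependent (h : IsUnitriangular b φ v) : LinearIndependent R v := by
  classical
  rw [linearIndependent_iff_finset_linearIndependent]
  intro S
  rw [Fintype.linearIndependent_iff]
  intro c hc
  refine congrFun (Matrix.mulVec_injective_of_isUnit (h.isUnit_matrix S) (funext fun i => ?_))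
  simpa [Matrix.mulVec, dotProduct, mul_comm] using congrArg (φ i) hc

theorem exists_mem_span (h : IsUnitriangular b φ v) (S : Finset ι) (c : ι → R) :
    ∃ x ∈ Submodule.span R (v '' S), ∀ i ∈ S, φ i x = c i := by
  classical
  obtain ⟨a, ha⟩ := Matrix.mulVec_surjective_iff_isUnit.2 (h.isUnit_matrix S) fun i => c i
  refine ⟨∑ j : S, a j • v j, Submodule.sum_mem _ fun j _ => Submodule.smul_mem _ _
    (Submodule.subset_span ⟨j, j.2, rfl⟩), fun i hi => ?_⟩
  rw [← congrFun ha ⟨i, hi⟩]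
  simp [Matrix.mulVec, dotProduct, mul_comm]

end IsUnitriangular

end Unitriangular

section LeadingTerm

variable {lam mu : YoungDiagram}

/-- The columns of the filling `T` that contain the letter `k`. -/
def letterColumns (T : skewCells lam mu → ℕ) (k : ℕ) : Finset ℕ :=
  (Finset.univ.filter fun a => T a = k).image fun a => a.1.2

theorem card_letterColumns (T : skewCells lam mu → ℕ) (k : ℕ) :
    (letterColumns T k).card = rppWeight T k :=
  rfl

theorem mem_skewCells_bot {c : ℕ × ℕ} : c ∈ skewCells lam ⊥ ↔ c ∈ lam :=
  mem_skewCells.trans (and_iff_left (YoungDiagram.notMem_bot c))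

/-- The entries of column `c` of a filling of a straight shape, from top to bottom. -/
def columnEntries (T : skewCells lam ⊥ → ℕ) (c : ℕ) (i : Fin (lam.colLen c)) : ℕ :=
  T ⟨(i, c), mem_skewCells_bot.2 (YoungDiagram.mem_iff_lt_colLen.2 i.2)⟩

variable {T : skewCells lam ⊥ → ℕ} {c k : ℕ}

theorem mem_letterColumns : c ∈ letterColumns T k ↔ k ∈ Finset.univ.image (columnEntries T c) := by
  simp only [letterColumns, Finset.mem_image, Finset.mem_filter, Finset.mem_univ, true_and]
  constructor
  · rintro ⟨⟨⟨i, c⟩, ha⟩, rfl, rfl⟩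
    exact ⟨⟨i, YoungDiagram.mem_iff_lt_colLen.1 (mem_skewCells_bot.1 ha)⟩, rfl⟩
  · rintro ⟨i, rfl⟩
    exact ⟨_, rfl, rfl⟩

theorem lt_rowLen_iff_lt_colLen : c < lam.rowLen k ↔ k < lam.colLen c :=
  YoungDiagram.mem_iff_lt_rowLen.symm.trans YoungDiagram.mem_iff_lt_colLen

theorem image_columnEntries_eq_range
    (h : ∀ j < lam.colLen c, letterColumns T j = Finset.range (lam.rowLen j)) :
    Finset.univ.image (columnEntries T c) = Finset.range (lam.colLen c) := by
  refine (Finset.eq_of_subset_of_card_le (fun j hj => ?_) ?_).symm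
  · have hj := Finset.mem_range.1 hj
    rw [← mem_letterColumns, h j hj, Finset.mem_range, lt_rowLen_iff_lt_colLen]
    exact hj
  · exact Finset.card_image_le.trans_eq (by simp)

theorem letterColumns_subset_range
    (h : ∀ j < k, letterColumns T j = Finset.range (lam.rowLen j)) :
    letterColumns T k ⊆ Finset.range (lam.rowLen k) := by
  intro c hc
  rw [Finset.mem_range, lt_rowLen_iff_lt_colLen]
  by_contra! hk
  rw [mem_letterColumns, image_columnEntries_eq_range fun j hj => h j (hj.trans_le hk),
    Finset.mem_range] at hc
  exact hk.not_gt hc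

theorem letterColumns_eq_range (h : ∀ j ≤ k, rppWeight T j = lam.rowLen j) :
    letterColumns T k = Finset.range (lam.rowLen k) := by
  induction k using Nat.strong_induction_on with
  | _ k ih =>
    refine Finset.eq_of_subset_of_card_le (letterColumns_subset_range fun j hj =>
      ih j hj fun l hl => h l (hl.trans hj.le)) ?_
    rw [Finset.card_range, card_letterColumns, h k le_rfl]

theorem toLex_rppWeight_le (T : skewCells lam ⊥ → ℕ) :
    toLex (rppWeight T) ≤ toLex (rowLengths lam) := by
  by_contra! hlt
  obtain ⟨k, heq, hlt⟩ := Finsupp.Lex.lt_iff.1 hlt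
  have hsubset := letterColumns_subset_range (T := T) fun j hj =>
    letterColumns_eq_range fun l hl => (heq l (hl.trans_lt hj)).symm
  have hcard := Finset.card_le_card hsubset
  rw [Finset.card_range, card_letterColumns] at hcard
  exact hcard.not_gt hlt

theorem IsReversePlanePartition.eq_row_of_rppWeight_eq (hT : IsReversePlanePartition T)
    (hweight : rppWeight T = rowLengths lam) : T = fun a => a.1.1 := by
  funext ⟨⟨i, c⟩, ha⟩
  have himage : Finset.univ.image (columnEntries T c) = Finset.range (lam.colLen c) :=
    image_columnEntries_eq_range fun j _ => letterColumns_eq_range fun l _ => congr($hweight l)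
  have hinj : Function.Injective (columnEntries T c) := by
    rw [← Set.injOn_univ, ← Finset.coe_univ, ← Finset.card_image_iff, himage, Finset.card_range,
      Finset.card_fin]
  have hmono : StrictMono (columnEntries T c) :=
    Monotone.strictMono_of_injective (fun i j hij => hT.2 _ _ rfl hij) hinj
  have hval : columnEntries T c = Fin.val := by
    refine (hmono.range_inj Fin.val_strictMono).1 ?_
    rw [Fin.range_val, ← Set.image_univ, ← Finset.coe_univ, ← Finset.coe_image, himage,
      Finset.coe_range]
  exact congrFun hval ⟨i, YoungDiagram.mem_iff_lt_colLen.1 (mem_skewCells_bot.1 ha)⟩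

theorem isReversePlanePartition_row : IsReversePlanePartition fun a : skewCells lam mu => a.1.1 :=
  ⟨fun _ _ h _ => h.le, fun _ _ _ h => h⟩

theorem rppWeight_row (lam : YoungDiagram) :
    rppWeight (fun a : skewCells lam ⊥ => a.1.1) = rowLengths lam := by
  ext k
  rw [← card_letterColumns, rowLengths_apply, ← Finset.card_range (lam.rowLen k)]
  congr 1
  ext c
  rw [mem_letterColumns, Finset.mem_range, lt_rowLen_iff_lt_colLen]
  simp [columnEntries, Fin.exists_iff]

theorem rppsOfWeight_rowLengths (lam : YoungDiagram) :
    rppsOfWeight lam ⊥ (rowLengths lam) = {fun a => a.1.1} :=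
  Set.eq_singleton_iff_unique_mem.2 ⟨⟨isReversePlanePartition_row, rppWeight_row lam⟩,
    fun _ hT => hT.1.eq_row_of_rppWeight_eq hT.2⟩

end LeadingTerm

section DualGrothendieckBasis

variable {K : Type*} [CommRing K] {lam mu : YoungDiagram}

theorem coeff_dualGrothendieck (lam mu : YoungDiagram) (m : ℕ →₀ ℕ) :
    MvPowerSeries.coeff m (dualGrothendieck K lam mu) = (rppsOfWeight lam mu m).ncard :=
  rfl

theorem exists_rppWeight_eq_of_coeff_ne_zero {m : ℕ →₀ ℕ}
    (h : MvPowerSeries.coeff m (dualGrothendieck K lam mu) ≠ 0) :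
    ∃ T : skewCells lam mu → ℕ, rppWeight T = m := by
  rw [coeff_dualGrothendieck] at h
  obtain ⟨T, -, hT⟩ := Set.nonempty_of_ncard_ne_zero fun h0 => h (by rw [h0, Nat.cast_zero])
  exact ⟨T, hT⟩

theorem degree_rppWeight_le (T : skewCells lam mu → ℕ) : (rppWeight T).degree ≤ lam.card := by
  rw [Finsupp.degree_apply]
  calc ∑ k ∈ (rppWeight T).support, rppWeight T k
      ≤ ∑ k ∈ Finset.univ.image T, rppWeight T k :=
        Finset.sum_le_sum_of_subset Finsupp.support_onFinset_subset
    _ ≤ ∑ k ∈ Finset.univ.image T, (Finset.univ.filter fun a => T a = k).card :=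
        Finset.sum_le_sum fun k _ => Finset.card_image_le
    _ = (Finset.univ : Finset (skewCells lam mu)).card :=
        (Finset.card_eq_sum_card_image T _).symm
    _ = (skewCells lam mu).card := Finset.card_attach
    _ ≤ lam.card := Finset.card_le_card Finset.sdiff_subset

variable (K)

theorem dualGrothendieck_mem_degreeLE (lam mu : YoungDiagram) :
    dualGrothendieck K lam mu ∈ degreeLE ℕ K lam.card := by
  intro m hm
  by_contra h
  obtain ⟨T, rfl⟩ := exists_rppWeight_eq_of_coeff_ne_zero h
  exact (degree_rppWeight_le T).not_gt hm

theorem dualGrothendieck_mem_symmetricFunctions (hle : mu ≤ lam) :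
    dualGrothendieck K lam mu ∈ symmetricFunctions K := by
  refine ⟨fun i => renameEquiv_eq_self_iff.2 fun m => ?_, _, dualGrothendieck_mem_degreeLE K lam mu⟩
  rw [coeff_dualGrothendieck, coeff_dualGrothendieck, ncard_rppsOfWeight_swap hle]

theorem isUnitriangular_dualGrothendieck :
    IsUnitriangular (fun lam : YoungDiagram => toLex (rowLengths lam))
      (fun lam => MvPowerSeries.coeff (R := K) (rowLengths lam))
      (fun lam => dualGrothendieck K lam ⊥) where
  injective := toLex.injective.comp rowLengths_injective
  apply_self lam := by
    rw [coeff_dualGrothendieck, rppsOfWeight_rowLengths, Set.ncard_singleton, Nat.cast_one]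
  apply_of_lt lam kap hlt := by
    by_contra h
    obtain ⟨T, hT⟩ := exists_rppWeight_eq_of_coeff_ne_zero h
    exact (hT ▸ toLex_rppWeight_le T).not_gt hlt

variable {K}

theorem mem_span_dualGrothendieck {f : MvPowerSeries ℕ K} (hf : f ∈ symmetricFunctions K) :
    f ∈ Submodule.span K (Set.range fun lam => dualGrothendieck K lam ⊥) := by
  obtain ⟨D, hD⟩ := hf.2
  obtain ⟨g, hg, hfg⟩ := (isUnitriangular_dualGrothendieck K).exists_mem_span
    (finite_setOf_card_le D).toFinset fun lam => MvPowerSeries.coeff (rowLengths lam) f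
  suffices hsub : f - g = 0 by
    rw [sub_eq_zero.1 hsub]
    exact Submodule.span_mono (Set.image_subset_range _ _) hg
  have hgS : g ∈ symmetricFunctions K := by
    refine (Submodule.span_le (p := Subalgebra.toSubmodule (symmetricFunctions K))).2 ?_ hg
    rintro _ ⟨lam, -, rfl⟩
    exact dualGrothendieck_mem_symmetricFunctions K bot_le
  have hgD : g ∈ degreeLE ℕ K D := by
    refine Submodule.span_le.2 ?_ hg
    rintro _ ⟨lam, hlam, rfl⟩
    exact degreeLE_mono (by simpa using hlam) (dualGrothendieck_mem_degreeLE K lam ⊥)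
  refine eq_zero_of_coeff_rowLengths_eq_zero (sub_mem hf hgS) (sub_mem hD hgD) fun lam hlam => ?_
  rw [map_sub, hfg lam (by simpa using hlam), sub_self]

theorem existsUnique_isExpansion {f : MvPowerSeries ℕ K} (hf : f ∈ symmetricFunctions K) :
    ∃! a : YoungDiagram →₀ K, IsExpansion f a := by
  obtain ⟨a, ha⟩ := Finsupp.mem_span_range_iff_exists_finsupp.1 (mem_span_dualGrothendieck hf)
  exact ⟨a, ha.symm, fun b hb =>
    (isUnitriangular_dualGrothendieck K).linearIndependent (hb.symm.trans ha.symm)⟩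

end DualGrothendieckBasis

section Specialization

variable {K : Type*} [CommRing K] {lam mu : YoungDiagram}

variable (K) in
/-- The specialization of the ring of power series in `x_0, x_1, …` that keeps `x_0` and sets
all other variables to `0`. -/
noncomputable def firstVariable : MvPowerSeries ℕ K →ₐ[K] PowerSeries K :=
  MvPowerSeries.killCompl (Function.Embedding.punit 0)

theorem coeff_firstVariable (f : MvPowerSeries ℕ K) (n : ℕ) :
    PowerSeries.coeff n (firstVariable K f) = MvPowerSeries.coeff (Finsupp.single 0 n) f := by
  rw [PowerSeries.coeff, firstVariable, MvPowerSeries.coeff_killCompl, Finsupp.embDomain_single]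
  rfl

theorem rppWeight_apply_ne_zero (T : skewCells lam mu → ℕ) (a : skewCells lam mu) :
    rppWeight T (T a) ≠ 0 :=
  Finset.card_ne_zero_of_mem <|
    Finset.mem_image_of_mem _ (Finset.mem_filter.2 ⟨Finset.mem_univ a, rfl⟩)

theorem rppWeight_zero (lam mu : YoungDiagram) :
    rppWeight (0 : skewCells lam mu → ℕ) = Finsupp.single 0 (numColumns lam mu) := by
  ext k
  rw [← card_letterColumns, letterColumns]
  rcases eq_or_ne k 0 with rfl | hk
  · simp only [Pi.zero_apply, Finset.filter_true]
    rw [Finsupp.single_eq_same, numColumns]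
    congr 1
    ext j
    simp
  · simp only [Pi.zero_apply, hk.symm, Finset.filter_false, Finset.image_empty,
      Finset.card_empty, Finsupp.single_eq_of_ne hk]

theorem rppsOfWeight_single_zero (lam mu : YoungDiagram) (n : ℕ) :
    rppsOfWeight lam mu (Finsupp.single 0 n) = {T | T = 0 ∧ n = numColumns lam mu} := by
  ext T
  constructor
  · rintro ⟨-, hT⟩
    have hT0 : T = 0 := by
      funext a
      by_contra h
      exact rppWeight_apply_ne_zero T a (hT ▸ Finsupp.single_eq_of_ne h)
    refine ⟨hT0, ?_⟩
    rw [hT0, rppWeight_zero] at hT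
    exact (Finsupp.single_injective 0 hT).symm
  · rintro ⟨rfl, rfl⟩
    exact ⟨⟨fun _ _ _ _ => le_rfl, fun _ _ _ _ => le_rfl⟩, rppWeight_zero lam mu⟩

theorem firstVariable_dualGrothendieck (lam mu : YoungDiagram) :
    firstVariable K (dualGrothendieck K lam mu) = PowerSeries.X ^ numColumns lam mu := by
  ext n
  rw [coeff_firstVariable, coeff_dualGrothendieck, rppsOfWeight_single_zero,
    PowerSeries.coeff_X_pow]
  split_ifs with h <;> simp [h]

theorem IsExpansion.pow_eq_sum {f : MvPowerSeries ℕ K} {a : YoungDiagram →₀ K}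
    (ha : IsExpansion f a) {C : ℕ} (hf : firstVariable K f = PowerSeries.X ^ C) (t : K) :
    t ^ C = a.sum fun lam r => r * t ^ numColumns lam ⊥ := by
  have hX : (Polynomial.X : Polynomial K) ^ C =
      a.sum fun lam r => r • Polynomial.X ^ numColumns lam ⊥ := by
    refine Polynomial.coe_injective K ?_
    rw [ha, map_finsuppSum] at hf
    simp only [map_smul, firstVariable_dualGrothendieck] at hf
    rw [← Polynomial.coeToPowerSeries.ringHom_apply, ← Polynomial.coeToPowerSeries.ringHom_apply,
      map_finsuppSum]
    simpa [Polynomial.smul_eq_C_mul, PowerSeries.smul_eq_C_mul] using hf.symm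
  simpa [Finsupp.sum, Polynomial.eval_finsetSum] using congrArg (Polynomial.eval t) hX

theorem IsExpansion.sum_eq_one {f : MvPowerSeries ℕ K} {a : YoungDiagram →₀ K}
    (ha : IsExpansion f a) {C : ℕ} (hf : firstVariable K f = PowerSeries.X ^ C) :
    a.sum (fun _ r => r) = 1 := by
  simpa using (ha.pow_eq_sum hf 1).symm

theorem existsUnique_isExpansion_and_sum_eq {f : MvPowerSeries ℕ K}
    (hf : f ∈ symmetricFunctions K) {C : ℕ} (hC : firstVariable K f = PowerSeries.X ^ C) :
    (∃! a : YoungDiagram →₀ K, IsExpansion f a) ∧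
      ∀ a : YoungDiagram →₀ K, IsExpansion f a → a.sum (fun _ r => r) = 1 ∧
        ∀ t : K, t ^ C = a.sum fun lam r => r * t ^ numColumns lam ⊥ :=
  ⟨existsUnique_isExpansion hf, fun _ ha => ⟨ha.sum_eq_one hC, ha.pow_eq_sum hC⟩⟩

end Specialization

theorem mainTheorem12 {K : Type*} [CommRing K] :
    (∀ mu nu : YoungDiagram,
      (∃! d : YoungDiagram →₀ K,
        IsExpansion (dualGrothendieck K mu ⊥ * dualGrothendieck K nu ⊥) d) ∧
      ∀ d : YoungDiagram →₀ K,
        IsExpansion (dualGrothendieck K mu ⊥ * dualGrothendieck K nu ⊥) d →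
          d.sum (fun _ r => r) = 1 ∧
          ∀ t : K, t ^ (numColumns mu ⊥ + numColumns nu ⊥) =
            d.sum (fun lam r => r * t ^ numColumns lam ⊥)) ∧
    (∀ lam mu : YoungDiagram, mu ≤ lam →
      (∃! c : YoungDiagram →₀ K, IsExpansion (dualGrothendieck K lam mu) c) ∧
      ∀ c : YoungDiagram →₀ K, IsExpansion (dualGrothendieck K lam mu) c →
          c.sum (fun _ r => r) = 1 ∧
          ∀ t : K, t ^ numColumns lam mu =
            c.sum (fun nu r => r * t ^ numColumns nu ⊥)) := by
  refine ⟨fun mu nu => existsUnique_isExpansion_and_sum_eq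
      (mul_mem (dualGrothendieck_mem_symmetricFunctions K bot_le)
        (dualGrothendieck_mem_symmetricFunctions K bot_le)) ?_,
    fun lam mu hle => existsUnique_isExpansion_and_sum_eq
      (dualGrothendieck_mem_symmetricFunctions K hle) (firstVariable_dualGrothendieck lam mu)⟩
  rw [map_mul, firstVariable_dualGrothendieck, firstVariable_dualGrothendieck, pow_add]
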